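/- Let $d\ge 1$ and let $\Omega\subset\mathbb R^d$ be a bounded open set (for instance a bounded Lipschitz domain with $d\in\{1,2,3\}$). Write $(\cdot,\cdot)$ and $\|\cdot\|$ for the inner product and norm of $L^2(\Omega)$ and of $[L^2(\Omega)]^d$, let $V=H^1_0(\Omega)$ be the closure of $C_c^\infty(\Omega)$ in $H^1(\Omega)$, and let $H(\mathrm{div},\Omega)=\{\tau\in[L^2(\Omega)]^d:\mathrm{div}\,\tau\in L^2(\Omega)\}$. Let $\nu$ be measurable with $0<\underline\nu\le\nu(x)\le\overline\nu$ for $x\in\Omega$, with constants $\underline\nu,\overline\nu$. Let $\lambda>0$, let $f,y_d,u_d,u_a,u_b\in L^2(\Omega)$ with $u_a\le u_b$ a.e. in $\Omega$, and put $U_{\rm ad}=\{v\in L^2(\Omega):u_a\le v\le u_b\text{ a.e. in }\Omega\}$. The optimal control problem is to minimize $\mathcal J(y,v)=\frac12\|y-y_d\|^2+\frac\lambda2\|v-u_d\|^2$ over $y\in V$, $v\in U_{\rm ad}$ subject to $(\nu\nabla y,\nabla w)=(f+v,w)$ for all $w\in V$. The optimality system for $(y,u,p)\in V\times U_{\rm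 ad}\times V$ is $$(\nu\nabla y,\nabla w)=(f+u,w)\ \ \forall w\in V,\qquad (\nu\nabla p,\nabla w)=(y-y_d,w)\ \ \forall w\in V,\qquad (p+\lambda(u-u_d),w-u)\ge 0\ \ \forall w\in U_{\rm ad}.$$ For $C_F>0$, $\alpha,\beta>0$, $\eta,\zeta\in V$, $\tau,\rho\in H(\mathrm{div},\Omega)$ and $v\in L^2(\Omega)$ put $$\begin{aligned}\mathcal M_1^\oplus(\alpha,\beta;\eta,\zeta,\tau,\rho,v)={}&\tfrac\alpha2\|\eta-y_d\|^2+\tfrac{(1+\alpha)(1+\beta)C_F^2}{2\alpha\underline\nu^2}\|\tau-\nu\nabla\eta\|^2+\tfrac{(1+\alpha)(1+\beta)C_F^4}{2\alpha\beta\underline\nu^2}\|f+v+\mathrm{div}\,\tau\|^2\\&-(f+v+\mathrm{div}\,\tau,\zeta)-(\tau-\nu\nabla\eta,\nabla\zeta)+\tfrac1{\underline\nu}\big(C_F\|\eta-y_d+\mathrm{div}\,\rho\|+\|\rho-\nu\nabla\zeta\|\big)\\&\quad\times\Big(\tfrac{C_F^3}{\lambda\underline\nu}\|\eta-y_d+\mathrm{div}\,\rho\|+\tfrac{C_F^2}{\lambda\underline\nu}\|\rho-\nu\nabla\zeta\|+C_F\|f+v+\mathrm{div}\,\tau\|+\|\tau-\nu\nabla\eta\|\Big)\\&+\tfrac{3\lambda}{2C_F^2}\big(\|\tau-\nu\nabla\eta\|+C_F\|f+v+\mathrm{div}\,\tau\|\big)^2.\end{aligned}$$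 For $\zeta\in V$ let $v_\zeta=\min\{u_b,\max\{u_a,u_d-\frac1\lambda\zeta\}\}$ a.e. in $\Omega$. Then the optimality system has exactly one solution; $(y,u,p)$ solves it if and only if $(y,u)$ solves the optimal control problem and $p$ solves the adjoint equation $(\nu\nabla p,\nabla w)=(y-y_d,w)$ for all $w\in V$; there is a constant $C_F>0$ satisfying the Friedrichs inequality $\|w\|\le C_F\|\nabla w\|$ for all $w\in V$; and for every such $C_F$, $$\inf_{\eta,\zeta\in V,\ \tau,\rho\in H(\mathrm{div},\Omega),\ \alpha,\beta>0}\mathcal M_1^\oplus(\alpha,\beta;\eta,\zeta,\tau,\rho,v_\zeta)=0.$$ The infimum is approached at the exact solution and the exact fluxes as $\alpha\to0$: if $(y,u,p)$ is the solution of the optimality system, then $v_p=u$, the fields $\nu\nabla y$ and $\nu\nabla p$ belong to $H(\mathrm{div},\Omega)$, and for every $\beta>0$ $$\lim_{\alpha\to0^+}\mathcal M_1^\oplus(\alpha,\beta;y,p,\nu\nabla y,\nu\nabla p,u)=0.$$ -/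

import Mathlib

open MeasureTheory Filter Topology
open scoped ContDiff RealInnerProductSpace

noncomputable section

namespace EllipticControl

/-- Euclidean space `ℝ^d`. -/
abbrev E (d : ℕ) : Type := EuclideanSpace ℝ (Fin d)

/-- `L²(Ω)`, with Mathlib's Hilbert space structure and its a.e. order. -/
abbrev L2 {d : ℕ} (Ω : Set (E d)) : Type := Lp ℝ 2 (volume.restrict Ω)

/-- `[L²(Ω)]^d`. -/
abbrev L2Vec {d : ℕ} (Ω : Set (E d)) : Type := Lp (E d) 2 (volume.restrict Ω)

/-- Test functions: `φ ∈ C_c^∞(Ω)`. -/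
structure IsTest {d : ℕ} (Ω : Set (E d)) (φ : E d → ℝ) : Prop where
  smooth : ContDiff ℝ ∞ φ
  compact : HasCompactSupport φ
  supp : tsupport φ ⊆ Ω

theorem IsTest.continuous_gradient {d : ℕ} {Ω : Set (E d)} {φ : E d → ℝ} (h : IsTest Ω φ) :
    Continuous (gradient φ) :=
  (InnerProductSpace.toDual ℝ (E d)).symm.continuous.comp (h.smooth.continuous_fderiv (by simp))

theorem IsTest.compact_gradient {d : ℕ} {Ω : Set (E d)} {φ : E d → ℝ} (h : IsTest Ω φ) :
    HasCompactSupport (gradient φ) :=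
  (h.compact.fderiv ℝ).comp_left (g := (InnerProductSpace.toDual ℝ (E d)).symm) (map_zero _)

theorem IsTest.memLp {d : ℕ} {Ω : Set (E d)} {φ : E d → ℝ} (h : IsTest Ω φ) :
    MemLp φ 2 (volume.restrict Ω) :=
  (h.smooth.continuous.memLp_of_hasCompactSupport h.compact).restrict Ω

theorem IsTest.memLp_gradient {d : ℕ} {Ω : Set (E d)} {φ : E d → ℝ} (h : IsTest Ω φ) :
    MemLp (gradient φ) 2 (volume.restrict Ω) :=
  (h.continuous_gradient.memLp_of_hasCompactSupport h.compact_gradient).restrict Ω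

theorem IsTest.zero {d : ℕ} (Ω : Set (E d)) : IsTest Ω (0 : E d → ℝ) :=
  ⟨contDiff_const, HasCompactSupport.zero, by simp⟩

theorem IsTest.add {d : ℕ} {Ω : Set (E d)} {φ ψ : E d → ℝ} (h : IsTest Ω φ) (k : IsTest Ω ψ) :
    IsTest Ω (φ + ψ) :=
  ⟨h.smooth.add k.smooth, h.compact.add k.compact,
    (tsupport_add φ ψ).trans (Set.union_subset h.supp k.supp)⟩

theorem IsTest.smul {d : ℕ} {Ω : Set (E d)} {φ : E d → ℝ} (c : ℝ) (h : IsTest Ω φ) :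
    IsTest Ω (c • φ) :=
  ⟨h.smooth.const_smul c, h.compact.smul_left (f := fun _ => c),
    (closure_mono (Function.support_const_smul_subset c φ)).trans h.supp⟩

/-- `g` is the weak gradient of `w` on `Ω`: for every `φ ∈ C_c^∞(Ω)` and every `i`,
`∫_Ω w ∂_i φ = - ∫_Ω g_i φ`. -/
def IsWeakGradient {d : ℕ} (Ω : Set (E d)) (w : L2 Ω) (g : L2Vec Ω) : Prop :=
  ∀ φ : E d → ℝ, IsTest Ω φ → ∀ i : Fin d,
    ∫ x in Ω, w x * gradient φ x i = - ∫ x in Ω, g x i * φ x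

/-- `q` is the weak divergence of `τ` on `Ω`: for every `φ ∈ C_c^∞(Ω)`,
`∫_Ω q φ = - ∫_Ω τ · ∇φ`. -/
def IsWeakDivergence {d : ℕ} (Ω : Set (E d)) (τ : L2Vec Ω) (q : L2 Ω) : Prop :=
  ∀ φ : E d → ℝ, IsTest Ω φ →
    ∫ x in Ω, q x * φ x = - ∫ x in Ω, ⟪τ x, gradient φ x⟫

theorem integrable_coord_mul {d : ℕ} {Ω : Set (E d)} {φ : E d → ℝ} (h : IsTest Ω φ)
    (g : L2Vec Ω) (i : Fin d) : Integrable (fun x => g x i * φ x) (volume.restrict Ω) :=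
  MemLp.integrable_mul ((Lp.memLp g).continuousLinearMap_comp (EuclideanSpace.proj (𝕜 := ℝ) i))
    h.memLp

theorem integrable_mul_coord {d : ℕ} {Ω : Set (E d)} {φ : E d → ℝ} (h : IsTest Ω φ)
    (w : L2 Ω) (i : Fin d) :
    Integrable (fun x => w x * gradient φ x i) (volume.restrict Ω) :=
  MemLp.integrable_mul (Lp.memLp w)
    (h.memLp_gradient.continuousLinearMap_comp (EuclideanSpace.proj (𝕜 := ℝ) i))

theorem integrable_mul_test {d : ℕ} {Ω : Set (E d)} {φ : E d → ℝ} (h : IsTest Ω φ)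
    (q : L2 Ω) : Integrable (fun x => q x * φ x) (volume.restrict Ω) :=
  MemLp.integrable_mul (Lp.memLp q) h.memLp

theorem integrable_inner_gradient {d : ℕ} {Ω : Set (E d)} {φ : E d → ℝ} (h : IsTest Ω φ)
    (τ : L2Vec Ω) : Integrable (fun x => ⟪τ x, gradient φ x⟫) (volume.restrict Ω) :=
  by
  have := L2.integrable_inner (𝕜 := ℝ) τ h.memLp_gradient.toLp
  refine this.congr ?_
  filter_upwards [h.memLp_gradient.coeFn_toLp] with x hx
  rw [hx]

theorem gradient_add_of_test {d : ℕ} {Ω : Set (E d)} {φ ψ : E d → ℝ} (h : IsTest Ω φ)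
    (k : IsTest Ω ψ) : gradient (φ + ψ) = gradient φ + gradient ψ := by
  funext x
  simp only [gradient, Pi.add_apply]
  rw [fderiv_add (h.smooth.differentiable (by simp) x) (k.smooth.differentiable (by simp) x),
    map_add]

theorem gradient_smul_of_test {d : ℕ} {Ω : Set (E d)} {φ : E d → ℝ} (c : ℝ) (h : IsTest Ω φ) :
    gradient (c • φ) = c • gradient φ := by
  funext x
  simp only [gradient, Pi.smul_apply]
  rw [fderiv_const_smul (h.smooth.differentiable (by simp) x), map_smulₛₗ]
  simp

theorem gradient_zero_fun {d : ℕ} : gradient (0 : E d → ℝ) = 0 := by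
  funext x
  simp [gradient]

/-- `H¹(Ω)`. An element is the pair of a function `w.fst ∈ L²(Ω)` and its (unique) weak gradient
`w.snd ∈ [L²(Ω)]^d`; the inherited inner product is the standard one of `H¹(Ω)`. -/
def H1 {d : ℕ} (Ω : Set (E d)) : Submodule ℝ (WithLp 2 (L2 Ω × L2Vec Ω)) where
  carrier := {w | IsWeakGradient Ω w.fst w.snd}
  zero_mem' := by
    intro φ h i
    have h1 : (fun x => (0 : L2 Ω) x * gradient φ x i) =ᵐ[volume.restrict Ω] fun _ => 0 := by
      filter_upwards [Lp.coeFn_zero ℝ 2 (volume.restrict Ω)] with x hx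
      rw [hx]
      simp
    have h2 : (fun x => (0 : L2Vec Ω) x i * φ x) =ᵐ[volume.restrict Ω] fun _ => 0 := by
      filter_upwards [Lp.coeFn_zero (E d) 2 (volume.restrict Ω)] with x hx
      rw [hx]
      simp
    simp only [WithLp.zero_fst, WithLp.zero_snd]
    rw [integral_congr_ae h1, integral_congr_ae h2]
    simp
  add_mem' := by
    intro a b ha hb φ h i
    have h1 : (fun x => (a.fst + b.fst : L2 Ω) x * gradient φ x i) =ᵐ[volume.restrict Ω]
        fun x => a.fst x * gradient φ x i + b.fst x * gradient φ x i := by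
      filter_upwards [Lp.coeFn_add a.fst b.fst] with x hx
      rw [hx]
      simp only [Pi.add_apply, add_mul]
    have h2 : (fun x => (a.snd + b.snd : L2Vec Ω) x i * φ x) =ᵐ[volume.restrict Ω]
        fun x => a.snd x i * φ x + b.snd x i * φ x := by
      filter_upwards [Lp.coeFn_add a.snd b.snd] with x hx
      rw [hx]
      simp only [Pi.add_apply, PiLp.add_apply, add_mul]
    simp only [WithLp.add_fst, WithLp.add_snd]
    rw [integral_congr_ae h1, integral_congr_ae h2,
      integral_add (integrable_mul_coord h _ i) (integrable_mul_coord h _ i),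
      integral_add (integrable_coord_mul h _ i) (integrable_coord_mul h _ i), ha φ h i, hb φ h i]
    ring
  smul_mem' := by
    intro c a ha φ h i
    have h1 : (fun x => (c • a.fst : L2 Ω) x * gradient φ x i) =ᵐ[volume.restrict Ω]
        fun x => c * (a.fst x * gradient φ x i) := by
      filter_upwards [Lp.coeFn_smul c a.fst] with x hx
      rw [hx]
      simp only [Pi.smul_apply, smul_eq_mul, mul_assoc]
    have h2 : (fun x => (c • a.snd : L2Vec Ω) x i * φ x) =ᵐ[volume.restrict Ω]
        fun x => c * (a.snd x i * φ x) := by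
      filter_upwards [Lp.coeFn_smul c a.snd] with x hx
      rw [hx]
      simp only [Pi.smul_apply, PiLp.smul_apply, smul_eq_mul, mul_assoc]
    simp only [WithLp.smul_fst, WithLp.smul_snd]
    rw [integral_congr_ae h1, integral_congr_ae h2, integral_const_mul, integral_const_mul,
      ha φ h i]
    ring

/-- The image of `C_c^∞(Ω)` under `φ ↦ (φ, ∇φ)`. -/
def testPairs {d : ℕ} (Ω : Set (E d)) : Submodule ℝ (WithLp 2 (L2 Ω × L2Vec Ω)) where
  carrier := {w | ∃ φ : E d → ℝ, IsTest Ω φ ∧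
    w.fst =ᵐ[volume.restrict Ω] φ ∧ w.snd =ᵐ[volume.restrict Ω] gradient φ}
  zero_mem' := by
    refine ⟨0, IsTest.zero Ω, Lp.coeFn_zero ℝ 2 (volume.restrict Ω), ?_⟩
    rw [gradient_zero_fun]
    exact Lp.coeFn_zero (E d) 2 (volume.restrict Ω)
  add_mem' := by
    rintro a b ⟨φ, h, h1, h2⟩ ⟨ψ, k, k1, k2⟩
    refine ⟨φ + ψ, h.add k, (Lp.coeFn_add a.fst b.fst).trans (h1.add k1), ?_⟩
    rw [gradient_add_of_test h k]
    exact (Lp.coeFn_add a.snd b.snd).trans (h2.add k2)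
  smul_mem' := by
    rintro c a ⟨φ, h, h1, h2⟩
    refine ⟨c • φ, h.smul c, (Lp.coeFn_smul c a.fst).trans (h1.const_smul c), ?_⟩
    rw [gradient_smul_of_test c h]
    exact (Lp.coeFn_smul c a.snd).trans (h2.const_smul c)

/-- `V = H¹₀(Ω)`, the closure of `C_c^∞(Ω)` in `H¹(Ω)`. -/
def H10 {d : ℕ} (Ω : Set (E d)) : Submodule ℝ (WithLp 2 (L2 Ω × L2Vec Ω)) :=
  H1 Ω ⊓ (testPairs Ω).topologicalClosure

/-- The function underlying an element of `H¹₀(Ω)`. -/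
def H10.fn {d : ℕ} {Ω : Set (E d)} (w : H10 Ω) : L2 Ω := w.1.fst

/-- The weak gradient of an element of `H¹₀(Ω)`. -/
def H10.grad {d : ℕ} {Ω : Set (E d)} (w : H10 Ω) : L2Vec Ω := w.1.snd

/-- `H(div, Ω)`. An element is the pair of a field `τ.fst ∈ [L²(Ω)]^d` and its (unique) weak
divergence `τ.snd ∈ L²(Ω)`. -/
def Hdiv {d : ℕ} (Ω : Set (E d)) : Submodule ℝ (WithLp 2 (L2Vec Ω × L2 Ω)) where
  carrier := {τ | IsWeakDivergence Ω τ.fst τ.snd}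
  zero_mem' := by
    intro φ h
    have h1 : (fun x => (0 : L2 Ω) x * φ x) =ᵐ[volume.restrict Ω] fun _ => 0 := by
      filter_upwards [Lp.coeFn_zero ℝ 2 (volume.restrict Ω)] with x hx
      rw [hx]
      simp
    have h2 : (fun x => ⟪(0 : L2Vec Ω) x, gradient φ x⟫) =ᵐ[volume.restrict Ω] fun _ => 0 := by
      filter_upwards [Lp.coeFn_zero (E d) 2 (volume.restrict Ω)] with x hx
      rw [hx]
      simp
    simp only [WithLp.zero_fst, WithLp.zero_snd]
    rw [integral_congr_ae h1, integral_congr_ae h2]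
    simp
  add_mem' := by
    intro a b ha hb φ h
    have h1 : (fun x => (a.snd + b.snd : L2 Ω) x * φ x) =ᵐ[volume.restrict Ω]
        fun x => a.snd x * φ x + b.snd x * φ x := by
      filter_upwards [Lp.coeFn_add a.snd b.snd] with x hx
      rw [hx]
      simp only [Pi.add_apply, add_mul]
    have h2 : (fun x => ⟪(a.fst + b.fst : L2Vec Ω) x, gradient φ x⟫) =ᵐ[volume.restrict Ω]
        fun x => ⟪a.fst x, gradient φ x⟫ + ⟪b.fst x, gradient φ x⟫ := by
      filter_upwards [Lp.coeFn_add a.fst b.fst] with x hx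
      rw [hx, Pi.add_apply, inner_add_left]
    simp only [WithLp.add_fst, WithLp.add_snd]
    rw [integral_congr_ae h1, integral_congr_ae h2,
      integral_add (integrable_mul_test h _) (integrable_mul_test h _),
      integral_add (integrable_inner_gradient h _) (integrable_inner_gradient h _),
      ha φ h, hb φ h]
    ring
  smul_mem' := by
    intro c a ha φ h
    have h1 : (fun x => (c • a.snd : L2 Ω) x * φ x) =ᵐ[volume.restrict Ω]
        fun x => c * (a.snd x * φ x) := by
      filter_upwards [Lp.coeFn_smul c a.snd] with x hx
      rw [hx]
      simp only [Pi.smul_apply, smul_eq_mul, mul_assoc]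
    have h2 : (fun x => ⟪(c • a.fst : L2Vec Ω) x, gradient φ x⟫) =ᵐ[volume.restrict Ω]
        fun x => c * ⟪a.fst x, gradient φ x⟫ := by
      filter_upwards [Lp.coeFn_smul c a.fst] with x hx
      rw [hx, Pi.smul_apply, real_inner_smul_left]
    simp only [WithLp.smul_fst, WithLp.smul_snd]
    rw [integral_congr_ae h1, integral_congr_ae h2, integral_const_mul, integral_const_mul,
      ha φ h]
    ring

/-- The field underlying an element of `H(div, Ω)`. -/
def Hdiv.field {d : ℕ} {Ω : Set (E d)} (τ : Hdiv Ω) : L2Vec Ω := τ.1.fst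

/-- The divergence of an element of `H(div, Ω)`. -/
def Hdiv.div {d : ℕ} {Ω : Set (E d)} (τ : Hdiv Ω) : L2 Ω := τ.1.snd

open Classical in
/-- The field `ν g ∈ [L²(Ω)]^d` for `g ∈ [L²(Ω)]^d`. For bounded measurable `ν` the product is
always in `[L²(Ω)]^d`; see `coeFn_flux`. -/
def flux {d : ℕ} {Ω : Set (E d)} (ν : E d → ℝ) (g : L2Vec Ω) : L2Vec Ω :=
  if h : MemLp (fun x => ν x • g x) 2 (volume.restrict Ω) then h.toLp _ else 0

theorem coeFn_flux {d : ℕ} {Ω : Set (E d)} (hΩ : IsOpen Ω) {ν : E d → ℝ} {νlow νup : ℝ}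
    (hm : AEMeasurable ν (volume.restrict Ω)) (h0 : 0 < νlow)
    (hb : ∀ x ∈ Ω, νlow ≤ ν x ∧ ν x ≤ νup) (g : L2Vec Ω) :
    flux ν g =ᵐ[volume.restrict Ω] fun x => ν x • g x := by
  have h : MemLp (fun x => ν x • g x) 2 (volume.restrict Ω) := by
    refine MemLp.of_le_mul (c := νup) (Lp.memLp g)
      (hm.aestronglyMeasurable.smul (Lp.aestronglyMeasurable g)) ?_
    filter_upwards [ae_restrict_mem hΩ.measurableSet] with x hx
    rw [norm_smul, Real.norm_of_nonneg (h0.le.trans (hb x hx).1)]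
    exact mul_le_mul_of_nonneg_right (hb x hx).2 (norm_nonneg _)
  rw [flux, dif_pos h]
  exact h.coeFn_toLp

/-- The admissible controls `U_ad = {v ∈ L²(Ω) : u_a ≤ v ≤ u_b a.e. in Ω}`. -/
def Uad {d : ℕ} {Ω : Set (E d)} (ua ub : L2 Ω) : Set (L2 Ω) :=
  {v | ∀ᵐ x ∂(volume.restrict Ω), ua x ≤ v x ∧ v x ≤ ub x}

/-- The control `v_ζ = min {u_b, max {u_a, u_d - ζ/λ}}` (a.e. minimum and maximum). -/
def projControl {d : ℕ} {Ω : Set (E d)} (lam : ℝ) (ud ua ub ζ : L2 Ω) : L2 Ω :=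
  ub ⊓ (ua ⊔ (ud - (1 / lam) • ζ))

theorem coeFn_projControl {d : ℕ} {Ω : Set (E d)} (lam : ℝ) (ud ua ub ζ : L2 Ω) :
    projControl lam ud ua ub ζ =ᵐ[volume.restrict Ω]
      fun x => min (ub x) (max (ua x) (ud x - 1 / lam * ζ x)) := by
  filter_upwards [Lp.coeFn_inf ub (ua ⊔ (ud - (1 / lam) • ζ)),
    Lp.coeFn_sup ua (ud - (1 / lam) • ζ), Lp.coeFn_sub ud ((1 / lam) • ζ),
    Lp.coeFn_smul (1 / lam) ζ] with x h1 h2 h3 h4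
  rw [projControl, h1, Pi.inf_apply, h2, Pi.sup_apply, h3, Pi.sub_apply, h4, Pi.smul_apply,
    smul_eq_mul]

/-- The cost functional `J(y, v) = 1/2 ‖y - y_d‖² + λ/2 ‖v - u_d‖²`. -/
def cost {d : ℕ} {Ω : Set (E d)} (lam : ℝ) (yd ud y v : L2 Ω) : ℝ :=
  1 / 2 * ‖y - yd‖ ^ 2 + lam / 2 * ‖v - ud‖ ^ 2

/-- `y ∈ H¹₀(Ω)` solves `-div (ν ∇y) = r` weakly:
`∫_Ω ν ∇y · ∇w = ∫_Ω r w` for all `w ∈ H¹₀(Ω)`. -/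
def IsWeakSolution {d : ℕ} {Ω : Set (E d)} (ν : E d → ℝ) (r : L2 Ω) (y : H10 Ω) : Prop :=
  ∀ w : H10 Ω, ⟪flux ν (H10.grad y), H10.grad w⟫ = ⟪r, H10.fn w⟫

/-- `(y, u)` solves the optimal control problem: minimize `J(y, v)` over `y ∈ H¹₀(Ω)` and
`v ∈ U_ad` subject to `-div (ν ∇y) = f + v`. -/
structure IsOptimal {d : ℕ} {Ω : Set (E d)} (ν : E d → ℝ) (lam : ℝ) (f yd ud ua ub : L2 Ω)
    (y : H10 Ω) (u : L2 Ω) : Prop where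
  admissible : u ∈ Uad ua ub
  state : IsWeakSolution ν (f + u) y
  minimal : ∀ (z : H10 Ω) (v : L2 Ω), v ∈ Uad ua ub → IsWeakSolution ν (f + v) z →
    cost lam yd ud (H10.fn y) u ≤ cost lam yd ud (H10.fn z) v

/-- `(y, u, p)` solves the optimality system: the state equation, the adjoint equation and the
variational inequality `∫_Ω (p + λ (u - u_d)) (w - u) ≥ 0` for all `w ∈ U_ad`. -/
structure OptimalitySystem {d : ℕ} {Ω : Set (E d)} (ν : E d → ℝ) (lam : ℝ)
    (f yd ud ua ub : L2 Ω) (y : H10 Ω) (u : L2 Ω) (p : H10 Ω) : Prop where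
  admissible : u ∈ Uad ua ub
  state : IsWeakSolution ν (f + u) y
  adjoint : IsWeakSolution ν (H10.fn y - yd) p
  variational : ∀ w ∈ Uad ua ub, 0 ≤ ⟪H10.fn p + lam • (u - ud), w - u⟫

/-- `C` is an admissible constant in the Friedrichs inequality `‖w‖ ≤ C ‖∇w‖` on `H¹₀(Ω)`. -/
def IsFriedrichsConstant {d : ℕ} (Ω : Set (E d)) (C : ℝ) : Prop :=
  0 < C ∧ ∀ w : H10 Ω, ‖H10.fn w‖ ≤ C * ‖H10.grad w‖

/-- The error majorant `M₁^⊕(α, β; η, ζ, τ, ρ, v)`; here `νlow` is the lower bound of `ν` and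
`CF` the constant of the Friedrichs inequality. -/
def majorantH1 {d : ℕ} {Ω : Set (E d)} (ν : E d → ℝ) (νlow lam CF : ℝ) (f yd : L2 Ω)
    (α β : ℝ) (η ζ : H10 Ω) (τ ρ : Hdiv Ω) (v : L2 Ω) : ℝ :=
  α / 2 * ‖H10.fn η - yd‖ ^ 2
  + (1 + α) * (1 + β) * CF ^ 2 / (2 * α * νlow ^ 2)
      * ‖Hdiv.field τ - flux ν (H10.grad η)‖ ^ 2
  + (1 + α) * (1 + β) * CF ^ 4 / (2 * α * β * νlow ^ 2) * ‖f + v + Hdiv.div τ‖ ^ 2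
  - ⟪f + v + Hdiv.div τ, H10.fn ζ⟫
  - ⟪Hdiv.field τ - flux ν (H10.grad η), H10.grad ζ⟫
  + 1 / νlow * (CF * ‖H10.fn η - yd + Hdiv.div ρ‖ + ‖Hdiv.field ρ - flux ν (H10.grad ζ)‖)
      * (CF ^ 3 / (lam * νlow) * ‖H10.fn η - yd + Hdiv.div ρ‖
        + CF ^ 2 / (lam * νlow) * ‖Hdiv.field ρ - flux ν (H10.grad ζ)‖
        + CF * ‖f + v + Hdiv.div τ‖
        + ‖Hdiv.field τ - flux ν (H10.grad η)‖)
  + 3 * lam / (2 * CF ^ 2)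
      * (‖Hdiv.field τ - flux ν (H10.grad η)‖ + CF * ‖f + v + Hdiv.div τ‖) ^ 2

end EllipticControl

end

open EllipticControl

/-! The majorant is nonnegative for every control `v`, not only for `v_ζ`. Let `y` be the state of
`v`, let `e = y - η`, and write `r₁, r₂` for the residuals `f + v + div τ`, `τ - ν∇η` of the state
equation and `s₁, s₂` for the residuals `η - y_d + div ρ`, `ρ - ν∇ζ` of the adjoint equation.
Green's formula turns `(r₁, ζ) + (r₂, ∇ζ)` into `(ν∇e, ∇ζ)`, and coercivity with the Friedrichs
inequality bounds `‖∇e‖` by `(CF‖r₁‖ + ‖r₂‖)/νlow`. By Young's inequality the first three terms of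
the majorant dominate `½(‖η - y_d‖ + bound for ‖e‖)² - ½‖η - y_d‖²`, hence `(η - y_d, e)`. What
remains is `(η - y_d, e) - (ν∇ζ, ∇e) = (s₁, e) + (s₂, ∇e)`, which the product term compensates. This
is `majorantH1_nonneg`.

At the solution of the optimality system with the exact fluxes all residuals vanish and only `α/2 ‖y
- y_d‖²` survives (`majorantH1_exact`), so values arbitrarily close to zero occur as `α → 0`. They
are admissible in the infimum because `v_p = u`: both satisfy the same variational inequality.

The optimality system is handled through the solution operator (Lax–Milgram) and the symmetry of the
equation (`IsWeakSolution.inner_comm`). Existence is a projection onto a closed convex set. A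
quadratic growth estimate for the cost (`OptimalitySystem.cost_add_le`) gives the equivalence with
the control problem in both directions. -/

noncomputable section

namespace EllipticControl

/-! ### Weak derivatives, density of test functions, Green's formula and the Friedrichs inequality.
-/

section Sobolev

variable {d : ℕ} {Ω : Set (E d)}

theorem gradient_apply (φ : E d → ℝ) (x : E d) (i : Fin d) :
    gradient φ x i = fderiv ℝ φ x (EuclideanSpace.single i 1) := by
  have h : ⟪gradient φ x, EuclideanSpace.single i (1 : ℝ)⟫
      = fderiv ℝ φ x (EuclideanSpace.single i 1) := by
    rw [gradient, InnerProductSpace.toDual_symm_apply]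
  rw [← h, EuclideanSpace.inner_single_right]
  simp

theorem IsTest.gradient_eq_zero {φ : E d → ℝ} (h : IsTest Ω φ) {x : E d} (hx : x ∉ Ω) :
    gradient φ x = 0 := by
  have : fderiv ℝ φ x = 0 := by
    by_contra hne
    exact hx (h.supp (support_fderiv_subset ℝ hne))
  rw [gradient, this, map_zero]

theorem IsTest.eq_zero {φ : E d → ℝ} (h : IsTest Ω φ) {x : E d} (hx : x ∉ Ω) : φ x = 0 :=
  image_eq_zero_of_notMem_tsupport fun hh => hx (h.supp hh)

theorem IsTest.continuous_fderiv_apply {φ : E d → ℝ} (h : IsTest Ω φ) (v : E d) :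
    Continuous fun x => fderiv ℝ φ x v :=
  (h.smooth.continuous_fderiv (by simp)).clm_apply continuous_const

theorem IsTest.compact_fderiv_apply {φ : E d → ℝ} (h : IsTest Ω φ) (v : E d) :
    HasCompactSupport fun x => fderiv ℝ φ x v :=
  h.compact.fderiv_apply ℝ v

/-- Integration by parts for a smooth function against a test function. -/
theorem IsTest.integral_mul_gradient {φ ψ : E d → ℝ} (h : IsTest Ω φ) (k : ContDiff ℝ ∞ ψ)
    (i : Fin d) :
    ∫ x in Ω, ψ x * gradient φ x i = - ∫ x in Ω, gradient ψ x i * φ x := by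
  rw [setIntegral_eq_integral_of_forall_compl_eq_zero
      (fun x hx => by rw [h.gradient_eq_zero hx]; simp),
    setIntegral_eq_integral_of_forall_compl_eq_zero
      (fun x hx => by rw [h.eq_zero hx]; simp)]
  simp only [gradient_apply]
  have kc : Continuous fun x => fderiv ℝ ψ x (EuclideanSpace.single i 1) :=
    (k.continuous_fderiv (by simp)).clm_apply continuous_const
  apply integral_mul_fderiv_eq_neg_fderiv_mul_of_integrable
  · exact (kc.mul h.smooth.continuous).integrable_of_hasCompactSupport h.compact.mul_left
  · exact (k.continuous.mul (h.continuous_fderiv_apply _)).integrable_of_hasCompactSupport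
      (h.compact_fderiv_apply _).mul_left
  · exact (k.continuous.mul h.smooth.continuous).integrable_of_hasCompactSupport
      h.compact.mul_left
  · exact fun x _ => k.differentiable (by simp) x
  · exact fun x _ => h.smooth.differentiable (by simp) x

theorem testPairs_le_H1 : testPairs Ω ≤ H1 Ω := by
  rintro w ⟨ψ, k, h1, h2⟩ φ h i
  rw [integral_congr_ae (g := fun x => ψ x * gradient φ x i)
      (by filter_upwards [h1] with x hx; rw [hx]),
    integral_congr_ae (f := fun x => w.snd x i * φ x) (g := fun x => gradient ψ x i * φ x)
      (by filter_upwards [h2] with x hx; rw [hx])]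
  exact h.integral_mul_gradient k.smooth i

theorem IsTest.memLp_gradient_apply {φ : E d → ℝ} (h : IsTest Ω φ) (i : Fin d) :
    MemLp (fun x => gradient φ x i) 2 (volume.restrict Ω) :=
  h.memLp_gradient.continuousLinearMap_comp (EuclideanSpace.proj (𝕜 := ℝ) i)

theorem IsTest.memLp_single {φ : E d → ℝ} (h : IsTest Ω φ) (i : Fin d) :
    MemLp (fun x => φ x • EuclideanSpace.single i (1 : ℝ)) 2 (volume.restrict Ω) :=
  h.memLp.continuousLinearMap_comp
    (ContinuousLinearMap.toSpanSingleton ℝ (EuclideanSpace.single i (1 : ℝ)))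

theorem inner_toLp_eq {F : Type*} [NormedAddCommGroup F] [InnerProductSpace ℝ F]
    {μ : Measure (E d)} (q : Lp F 2 μ) {g : E d → F} (hg : MemLp g 2 μ) :
    ⟪q, hg.toLp g⟫ = ∫ x, ⟪q x, g x⟫ ∂μ := by
  rw [L2.inner_def]
  refine integral_congr_ae ?_
  filter_upwards [hg.coeFn_toLp] with x hx
  rw [hx]

/-- Written with `L²` inner products against fixed elements, the condition is visibly closed in the
pair `(w, g)`. -/
theorem isWeakGradient_iff (w : L2 Ω) (g : L2Vec Ω) :
    IsWeakGradient Ω w g ↔ ∀ (φ : E d → ℝ) (h : IsTest Ω φ) (i : Fin d),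
      ⟪w, (h.memLp_gradient_apply i).toLp⟫ = - ⟪g, (h.memLp_single i).toLp⟫ := by
  refine forall_congr' fun φ => forall_congr' fun h => forall_congr' fun i => ?_
  rw [inner_toLp_eq, inner_toLp_eq]
  simp only [real_inner_smul_right, EuclideanSpace.inner_single_right]
  simp only [RCLike.inner_apply, conj_trivial, mul_comm, one_mul]

theorem isWeakDivergence_iff (τ : L2Vec Ω) (q : L2 Ω) :
    IsWeakDivergence Ω τ q ↔ ∀ (φ : E d → ℝ) (h : IsTest Ω φ),
      ⟪q, h.memLp.toLp⟫ = - ⟪τ, h.memLp_gradient.toLp⟫ := by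
  refine forall_congr' fun φ => forall_congr' fun h => ?_
  rw [inner_toLp_eq, inner_toLp_eq]
  simp only [RCLike.inner_apply, conj_trivial, mul_comm]

theorem isClosed_H1 : IsClosed (H1 Ω : Set (WithLp 2 (L2 Ω × L2Vec Ω))) := by
  have : (H1 Ω : Set (WithLp 2 (L2 Ω × L2Vec Ω))) =
      ⋂ (φ : E d → ℝ) (h : IsTest Ω φ) (i : Fin d),
        {w | ⟪WithLp.fstL 2 ℝ _ _ w, (h.memLp_gradient_apply i).toLp⟫
          = - ⟪WithLp.sndL 2 ℝ _ _ w, (h.memLp_single i).toLp⟫} := by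
    ext w
    simp only [Set.mem_iInter]
    exact isWeakGradient_iff w.fst w.snd
  rw [this]
  refine isClosed_iInter fun φ => isClosed_iInter fun h => isClosed_iInter fun i => ?_
  exact isClosed_eq (by fun_prop) (by fun_prop)

/-- Completeness is what Lax–Milgram and the Hilbert space adjoint require of `H¹₀(Ω)`. -/
instance : CompleteSpace (H10 Ω) :=
  (isClosed_H1.inter (Submodule.isClosed_topologicalClosure _)).completeSpace_coe

/-- A closed condition that holds for all test functions holds on `H¹₀(Ω)`. -/
theorem H10.closed_induction {P : L2 Ω → L2Vec Ω → Prop}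
    (hP : IsClosed {w : WithLp 2 (L2 Ω × L2Vec Ω) | P w.fst w.snd})
    (h : ∀ (φ : E d → ℝ) (hφ : IsTest Ω φ), P hφ.memLp.toLp hφ.memLp_gradient.toLp)
    (w : H10 Ω) : P (H10.fn w) (H10.grad w) := by
  refine closure_minimal (s := (testPairs Ω : Set (WithLp 2 (L2 Ω × L2Vec Ω)))) ?_ hP w.2.2
  rintro z ⟨φ, hφ, h1, h2⟩
  have e1 : z.fst = hφ.memLp.toLp := Lp.ext (h1.trans hφ.memLp.coeFn_toLp.symm)
  have e2 : z.snd = hφ.memLp_gradient.toLp := Lp.ext (h2.trans hφ.memLp_gradient.coeFn_toLp.symm)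
  show P z.fst z.snd
  rw [e1, e2]
  exact h φ hφ

/-- The element of `H¹₀(Ω)` given by a test function. -/
def IsTest.toH10 {φ : E d → ℝ} (h : IsTest Ω φ) : H10 Ω :=
  ⟨WithLp.toLp 2 (h.memLp.toLp, h.memLp_gradient.toLp),
    have : WithLp.toLp 2 (h.memLp.toLp, h.memLp_gradient.toLp) ∈ testPairs Ω :=
      ⟨φ, h, h.memLp.coeFn_toLp, h.memLp_gradient.coeFn_toLp⟩
    ⟨testPairs_le_H1 this, (testPairs Ω).le_topologicalClosure this⟩⟩

/-- `H10.fn` as a continuous linear map. -/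
def H10.fnL (Ω : Set (E d)) : H10 Ω →L[ℝ] L2 Ω := (WithLp.fstL 2 ℝ _ _).comp (H10 Ω).subtypeL

/-- `H10.grad` as a continuous linear map. -/
def H10.gradL (Ω : Set (E d)) : H10 Ω →L[ℝ] L2Vec Ω :=
  (WithLp.sndL 2 ℝ _ _).comp (H10 Ω).subtypeL

theorem H10.fnL_apply (w : H10 Ω) : H10.fnL Ω w = H10.fn w := rfl

theorem H10.fn_sub (w z : H10 Ω) : H10.fn (w - z) = H10.fn w - H10.fn z := rfl

theorem H10.grad_sub (w z : H10 Ω) : H10.grad (w - z) = H10.grad w - H10.grad z := rfl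

theorem H10.norm_sq (w : H10 Ω) : ‖w‖ ^ 2 = ‖H10.fn w‖ ^ 2 + ‖H10.grad w‖ ^ 2 :=
  WithLp.prod_norm_sq_eq_of_L2 w.1

/-- Green's formula without boundary term: it is the definition of the weak divergence on test
functions, and both sides are continuous in the `H¹` norm. -/
theorem Hdiv.inner_div_add (τ : Hdiv Ω) (w : H10 Ω) :
    ⟪Hdiv.div τ, H10.fn w⟫ + ⟪Hdiv.field τ, H10.grad w⟫ = 0 := by
  refine H10.closed_induction (P := fun a b => ⟪Hdiv.div τ, a⟫ + ⟪Hdiv.field τ, b⟫ = 0) ?_ ?_ w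
  · have h : Continuous fun w : WithLp 2 (L2 Ω × L2Vec Ω) =>
        ⟪Hdiv.div τ, WithLp.fstL 2 ℝ _ _ w⟫ + ⟪Hdiv.field τ, WithLp.sndL 2 ℝ _ _ w⟫ := by
      fun_prop
    exact isClosed_eq h continuous_const
  · intro φ h
    have := (isWeakDivergence_iff _ _).1 τ.2 φ h
    exact this ▸ neg_add_cancel _

/-- A field whose pairing with gradients represents an `L²` functional lies in `H(div, Ω)`. -/
theorem exists_hdiv_of_inner_eq {g : L2Vec Ω} {r : L2 Ω}
    (h : ∀ w : H10 Ω, ⟪g, H10.grad w⟫ = ⟪r, H10.fn w⟫) :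
    ∃ τ : Hdiv Ω, Hdiv.field τ = g ∧ Hdiv.div τ = -r := by
  refine ⟨⟨WithLp.toLp 2 (g, -r), (isWeakDivergence_iff _ _).2 fun φ hφ => ?_⟩, rfl, rfl⟩
  have h2 : ⟪g, hφ.memLp_gradient.toLp⟫ = ⟪r, hφ.memLp.toLp⟫ := h hφ.toH10
  show ⟪-r, hφ.memLp.toLp⟫ = - ⟪g, hφ.memLp_gradient.toLp⟫
  rw [h2, inner_neg_left]

/-- Since `∂_i x_i = 1`, this is integration by parts of `φ²` against the coordinate function `x_i`.
It yields the Friedrichs inequality without slicing the domain. -/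
theorem IsTest.integral_sq_eq {φ : E d → ℝ} (h : IsTest Ω φ) (i : Fin d) :
    ∫ x in Ω, φ x * φ x = - ∫ x in Ω, φ x * (2 * x i * gradient φ x i) := by
  have hsq : IsTest Ω (fun x => φ x * φ x) :=
    ⟨h.smooth.mul h.smooth, h.compact.mul_left, (tsupport_mul_subset_left (f := φ)).trans h.supp⟩
  have hc : ContDiff ℝ ∞ fun x : E d => x i :=
    (EuclideanSpace.proj (𝕜 := ℝ) i : E d →L[ℝ] ℝ).contDiff
  have h1 := hsq.integral_mul_gradient hc i
  have e1 : ∀ x : E d, gradient (fun x : E d => x i) x i = 1 := fun x => by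
    rw [gradient_apply, show (fun x : E d => x i) = (EuclideanSpace.proj (𝕜 := ℝ) i : E d →L[ℝ] ℝ)
      from rfl, ContinuousLinearMap.fderiv]
    simp
  have e2 : ∀ x : E d, gradient (fun x => φ x * φ x) x i = 2 * φ x * gradient φ x i := fun x => by
    have hd := h.smooth.differentiable (by simp) x
    rw [gradient_apply, gradient_apply, fderiv_fun_mul hd hd]
    simp
    ring
  simp only [e1, e2, one_mul] at h1
  rw [← neg_eq_iff_eq_neg.2 h1]
  congr 1
  refine integral_congr_ae (ae_of_all _ fun x => ?_)
  ring

theorem exists_isFriedrichsConstant (hd : 1 ≤ d) (hΩo : IsOpen Ω)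
    (hΩb : Bornology.IsBounded Ω) : ∃ C : ℝ, IsFriedrichsConstant Ω C := by
  obtain ⟨R, hR0, hR⟩ := hΩb.exists_pos_norm_le
  -- `R` bounds `‖x‖` on `Ω`, and the factor 2 comes from `∂_i(φ²) = 2 φ ∂_i φ`.
  refine ⟨2 * R, by positivity, H10.closed_induction (P := fun a b => ‖a‖ ≤ 2 * R * ‖b‖) ?_ ?_⟩
  · have h1 : Continuous fun w : WithLp 2 (L2 Ω × L2Vec Ω) => ‖WithLp.fstL 2 ℝ _ _ w‖ := by
      fun_prop
    have h2 : Continuous fun w : WithLp 2 (L2 Ω × L2Vec Ω) =>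
        2 * R * ‖WithLp.sndL 2 ℝ _ _ w‖ := by
      fun_prop
    exact isClosed_le h1 h2
  intro φ h
  -- Any coordinate would do; `d ≥ 1` provides one.
  let i : Fin d := ⟨0, hd⟩
  have hb : ∀ᵐ x ∂(volume.restrict Ω),
      ‖2 * x i * gradient φ x i‖ ≤ 2 * R * ‖gradient φ x‖ := by
    filter_upwards [ae_restrict_mem hΩo.measurableSet] with x hx
    rw [norm_mul, norm_mul, Real.norm_ofNat]
    gcongr
    · exact (PiLp.norm_apply_le x i).trans (hR x hx)
    · exact PiLp.norm_apply_le _ i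
  have hg : MemLp (fun x => 2 * x i * gradient φ x i) 2 (volume.restrict Ω) := by
    refine h.memLp_gradient.of_le_mul ?_ hb
    have hc : Continuous fun x : E d => x i := (EuclideanSpace.proj (𝕜 := ℝ) i).continuous
    exact (hc.const_mul 2).aestronglyMeasurable.mul (h.memLp_gradient_apply i).1
  have hgn : ‖hg.toLp‖ ≤ 2 * R * ‖h.memLp_gradient.toLp‖ := by
    refine Lp.norm_le_mul_norm_of_ae_le_mul ?_
    filter_upwards [hg.coeFn_toLp, h.memLp_gradient.coeFn_toLp, hb] with x h1 h2 h3
    rwa [h1, h2]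
  have key : ‖h.memLp.toLp‖ ^ 2 = - ⟪h.memLp.toLp, hg.toLp⟫ := by
    have hφ := h.memLp.coeFn_toLp
    have e1 : ∫ x in Ω, ⟪(h.memLp.toLp : L2 Ω) x, φ x⟫ = ∫ x in Ω, φ x * φ x :=
      integral_congr_ae (by filter_upwards [hφ] with x hx; rw [hx]; rfl)
    have e2 : ∫ x in Ω, ⟪(h.memLp.toLp : L2 Ω) x, 2 * x i * gradient φ x i⟫
        = ∫ x in Ω, φ x * (2 * x i * gradient φ x i) :=
      integral_congr_ae (by filter_upwards [hφ] with x hx; rw [hx]; exact mul_comm _ _)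
    rw [← real_inner_self_eq_norm_sq, inner_toLp_eq, inner_toLp_eq, e1, e2]
    exact h.integral_sq_eq i
  have hcs := (neg_le_abs _).trans (abs_real_inner_le_norm h.memLp.toLp hg.toLp)
  rw [← key, sq] at hcs
  -- Cauchy–Schwarz gave `‖φ‖² ≤ ‖φ‖ ‖2 x_i ∂_i φ‖`; one factor `‖φ‖` is cancelled unless it is
  -- zero.
  rcases (norm_nonneg h.memLp.toLp).eq_or_lt with h0 | h0
  · rw [← h0]
    positivity
  · exact (le_of_mul_le_mul_left hcs h0).trans hgn

end Sobolev

/-- Existence for a quadratic control problem over a closed convex set, in the form of its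
variational inequality. -/
theorem exists_variational_inequality {H K : Type*} [NormedAddCommGroup H] [InnerProductSpace ℝ H]
    [CompleteSpace H] [NormedAddCommGroup K] [InnerProductSpace ℝ K] [CompleteSpace K]
    (T : H →L[ℝ] K) {U : Set H} (hne : U.Nonempty) (hcl : IsClosed U) (hconv : Convex ℝ U)
    {lam : ℝ} (hlam : 0 < lam) (c : K) (b : H) :
    ∃ u ∈ U, ∀ w ∈ U, 0 ≤ ⟪T u - c, T (w - u)⟫ + lam * ⟪u - b, w - u⟫ := by
  -- With `s² = 1/λ`, the cost `‖T w - c‖² + λ‖w - b‖²` is `λ` times the squared distance from `(s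
  -- c, b)` to `(s T w, w)`. The minimizer is therefore the projection of `(s c, b)` onto the graph
  -- `S` of `s T` over `U`, and the variational inequality is the obtuse-angle criterion for it.
  set s : ℝ := (√lam)⁻¹
  have hs : lam * (s * s) = 1 := by
    rw [← mul_inv, Real.mul_self_sqrt hlam.le, mul_inv_cancel₀ hlam.ne']
  let S : Set (WithLp 2 (K × H)) := {z | z.snd ∈ U ∧ z.fst = s • T z.snd}
  have hScl : IsClosed S := by
    have h1 : IsClosed {z : WithLp 2 (K × H) | z.snd ∈ U} :=
      hcl.preimage (WithLp.sndL 2 ℝ K H).continuous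
    have h2 : IsClosed {z : WithLp 2 (K × H) |
        WithLp.fstL 2 ℝ K H z = s • T (WithLp.sndL 2 ℝ K H z)} :=
      isClosed_eq (by fun_prop) (by fun_prop)
    exact h1.inter h2
  have hSconv : Convex ℝ S := by
    rintro x ⟨hx1, hx2⟩ y ⟨hy1, hy2⟩ a t ha ht hat
    refine ⟨hconv hx1 hy1 ha ht hat, ?_⟩
    simp only [WithLp.add_fst, WithLp.add_snd, WithLp.smul_fst, WithLp.smul_snd, hx2, hy2, map_add,
      map_smul, smul_add]
    rw [smul_comm a s, smul_comm t s]
  have hSmem : ∀ w ∈ U, WithLp.toLp 2 (s • T w, w) ∈ S := fun w hw => ⟨hw, rfl⟩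
  obtain ⟨w₀, hw₀⟩ := hne
  obtain ⟨z, hz, hmin⟩ := exists_norm_eq_iInf_of_complete_convex ⟨_, hSmem w₀ hw₀⟩
    hScl.isComplete hSconv (WithLp.toLp 2 (s • c, b))
  rw [norm_eq_iInf_iff_real_inner_le_zero hSconv hz] at hmin
  refine ⟨z.snd, hz.1, fun w hw => ?_⟩
  have h := hmin _ (hSmem w hw)
  rw [WithLp.prod_inner_apply] at h
  simp only [WithLp.ofLp_sub, Prod.fst_sub, Prod.snd_sub] at h
  have e1 : ⟪s • c - z.fst, s • T w - z.fst⟫ = -((s * s) * ⟪T z.snd - c, T (w - z.snd)⟫) := by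
    rw [hz.2, ← smul_sub, ← smul_sub, real_inner_smul_left, real_inner_smul_right, ← map_sub,
      ← neg_sub c, inner_neg_left]
    ring
  have e2 : ⟪b - z.snd, w - z.snd⟫ = - ⟪z.snd - b, w - z.snd⟫ := by
    rw [← neg_sub b, inner_neg_left, neg_neg]
  have h' : ⟪s • c - z.fst, s • T w - z.fst⟫ + ⟪b - z.snd, w - z.snd⟫ ≤ 0 := h
  rw [e1, e2] at h'
  have := mul_le_mul_of_nonneg_left h' hlam.le
  linear_combination this + ⟪T z.snd - c, T (w - z.snd)⟫ * hs

/-! ### The coefficient `ν` and the weak elliptic equation. -/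

section Flux

variable {d : ℕ} {Ω : Set (E d)} {ν : E d → ℝ} {νlow νup : ℝ}

theorem flux_sub (hΩ : IsOpen Ω) (hm : AEMeasurable ν (volume.restrict Ω)) (h0 : 0 < νlow)
    (hb : ∀ x ∈ Ω, νlow ≤ ν x ∧ ν x ≤ νup) (g h : L2Vec Ω) :
    flux ν (g - h) = flux ν g - flux ν h := by
  refine Lp.ext ?_
  filter_upwards [coeFn_flux hΩ hm h0 hb (g - h), coeFn_flux hΩ hm h0 hb g,
    coeFn_flux hΩ hm h0 hb h, Lp.coeFn_sub g h, Lp.coeFn_sub (flux ν g) (flux ν h)]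
    with x h1 h2 h3 h4 h5
  rw [h1, h5, h4, Pi.sub_apply, Pi.sub_apply, h2, h3, smul_sub]

/-- Multiplication by a bounded coefficient as a continuous linear map on `[L²(Ω)]^d`. -/
def fluxL (hΩ : IsOpen Ω) (hm : AEMeasurable ν (volume.restrict Ω)) (h0 : 0 < νlow)
    (hb : ∀ x ∈ Ω, νlow ≤ ν x ∧ ν x ≤ νup) : L2Vec Ω →L[ℝ] L2Vec Ω :=
  LinearMap.mkContinuous
    { toFun := flux ν
      map_add' := fun g h => by
        refine Lp.ext ?_
        filter_upwards [coeFn_flux hΩ hm h0 hb (g + h), coeFn_flux hΩ hm h0 hb g,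
          coeFn_flux hΩ hm h0 hb h, Lp.coeFn_add g h, Lp.coeFn_add (flux ν g) (flux ν h)]
          with x h1 h2 h3 h4 h5
        rw [h1, h5, h4, Pi.add_apply, Pi.add_apply, h2, h3, smul_add]
      map_smul' := fun c g => by
        refine Lp.ext ?_
        filter_upwards [coeFn_flux hΩ hm h0 hb (c • g), coeFn_flux hΩ hm h0 hb g,
          Lp.coeFn_smul c g, Lp.coeFn_smul c (flux ν g)] with x h1 h2 h3 h4
        rw [h1, RingHom.id_apply, h4, h3, Pi.smul_apply, Pi.smul_apply, h2, smul_comm] }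
    νup fun g => by
      refine Lp.norm_le_mul_norm_of_ae_le_mul ?_
      filter_upwards [coeFn_flux hΩ hm h0 hb g, ae_restrict_mem hΩ.measurableSet] with x h1 hx
      rw [LinearMap.coe_mk, AddHom.coe_mk, h1, norm_smul,
        Real.norm_of_nonneg (h0.le.trans (hb x hx).1)]
      exact mul_le_mul_of_nonneg_right (hb x hx).2 (norm_nonneg _)

theorem inner_flux_comm (hΩ : IsOpen Ω) (hm : AEMeasurable ν (volume.restrict Ω)) (h0 : 0 < νlow)
    (hb : ∀ x ∈ Ω, νlow ≤ ν x ∧ ν x ≤ νup) (g h : L2Vec Ω) :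
    ⟪flux ν g, h⟫ = ⟪flux ν h, g⟫ := by
  rw [L2.inner_def, L2.inner_def]
  refine integral_congr_ae ?_
  filter_upwards [coeFn_flux hΩ hm h0 hb g, coeFn_flux hΩ hm h0 hb h] with x h1 h2
  rw [h1, h2, real_inner_smul_left, real_inner_smul_left, real_inner_comm]

theorem mul_norm_sq_le_inner_flux (hΩ : IsOpen Ω) (hm : AEMeasurable ν (volume.restrict Ω))
    (h0 : 0 < νlow) (hb : ∀ x ∈ Ω, νlow ≤ ν x ∧ ν x ≤ νup) (g : L2Vec Ω) :
    νlow * ‖g‖ ^ 2 ≤ ⟪flux ν g, g⟫ := by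
  rw [← real_inner_self_eq_norm_sq, L2.inner_def, L2.inner_def, ← integral_const_mul]
  refine integral_mono_ae ((L2.integrable_inner g g).const_mul _) (L2.integrable_inner _ _) ?_
  filter_upwards [coeFn_flux hΩ hm h0 hb g, ae_restrict_mem hΩ.measurableSet] with x h1 hx
  rw [h1, real_inner_smul_left]
  exact mul_le_mul_of_nonneg_right (hb x hx).1 real_inner_self_nonneg

/-- The solution operator of `-div (ν ∇y) = r`. -/
theorem exists_solution_operator (hd : 1 ≤ d) (hΩ : IsOpen Ω) (hΩb : Bornology.IsBounded Ω)
    (hm : AEMeasurable ν (volume.restrict Ω))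
    (h0 : 0 < νlow) (hb : ∀ x ∈ Ω, νlow ≤ ν x ∧ ν x ≤ νup) :
    ∃ S : L2 Ω →L[ℝ] H10 Ω, ∀ r, IsWeakSolution ν r (S r) := by
  obtain ⟨C, hC0, hC⟩ := exists_isFriedrichsConstant hd hΩ hΩb
  let B : H10 Ω →L[ℝ] H10 Ω →L[ℝ] ℝ :=
    (innerSL ℝ).bilinearComp ((fluxL hΩ hm h0 hb).comp (H10.gradL Ω)) (H10.gradL Ω)
  have hB : ∀ y w, B y w = ⟪flux ν (H10.grad y), H10.grad w⟫ := fun y w => rfl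
  have hcoer : IsCoercive B := by
    -- By Friedrichs, `‖w‖²_{H¹} ≤ (C² + 1) ‖∇w‖²`.
    refine ⟨νlow / (C ^ 2 + 1), by positivity, fun w => ?_⟩
    rw [hB]
    refine le_trans ?_ (mul_norm_sq_le_inner_flux hΩ hm h0 hb (H10.grad w))
    have h1 : ‖w‖ * ‖w‖ ≤ (C ^ 2 + 1) * ‖H10.grad w‖ ^ 2 := by
      rw [← sq, H10.norm_sq]
      have := pow_le_pow_left₀ (norm_nonneg _) (hC w) 2
      linarith [mul_pow C ‖H10.grad w‖ 2]
    rw [mul_assoc, div_mul_eq_mul_div, div_le_iff₀ (by positivity), mul_assoc]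
    exact mul_le_mul_of_nonneg_left (by linarith) h0.le
  -- The adjoint of `H10.fnL` sends `r` to the Riesz representative of `w ↦ (r, w)` in `H¹₀(Ω)`; the
  -- inverse of the Lax–Milgram isomorphism then solves the equation, linearly and continuously in
  -- `r`.
  refine ⟨(hcoer.continuousLinearEquivOfBilin.symm : H10 Ω →L[ℝ] H10 Ω).comp
    (ContinuousLinearMap.adjoint (H10.fnL Ω)), fun r w => ?_⟩
  rw [← hB, ← hcoer.continuousLinearEquivOfBilin_apply]
  simp only [ContinuousLinearMap.comp_apply, ContinuousLinearEquiv.coe_coe,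
    ContinuousLinearEquiv.apply_symm_apply]
  rw [ContinuousLinearMap.adjoint_inner_left, H10.fnL_apply]

theorem IsWeakSolution.sub (hΩ : IsOpen Ω) (hm : AEMeasurable ν (volume.restrict Ω))
    (h0 : 0 < νlow) (hb : ∀ x ∈ Ω, νlow ≤ ν x ∧ ν x ≤ νup) {r q : L2 Ω} {y z : H10 Ω}
    (hy : IsWeakSolution ν r y) (hz : IsWeakSolution ν q z) :
    IsWeakSolution ν (r - q) (y - z) := fun w => by
  rw [H10.grad_sub, flux_sub hΩ hm h0 hb, inner_sub_left, inner_sub_left, hy w, hz w]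

theorem IsWeakSolution.unique (hd : 1 ≤ d) (hΩ : IsOpen Ω) (hΩb : Bornology.IsBounded Ω)
    (hm : AEMeasurable ν (volume.restrict Ω))
    (h0 : 0 < νlow) (hb : ∀ x ∈ Ω, νlow ≤ ν x ∧ ν x ≤ νup) {r : L2 Ω} {y z : H10 Ω}
    (hy : IsWeakSolution ν r y) (hz : IsWeakSolution ν r z) : y = z := by
  obtain ⟨C, -, hC⟩ := exists_isFriedrichsConstant hd hΩ hΩb
  have h := hy.sub hΩ hm h0 hb hz
  have h1 := mul_norm_sq_le_inner_flux hΩ hm h0 hb (H10.grad (y - z))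
  rw [h (y - z), sub_self, inner_zero_left] at h1
  have h2 : ‖H10.grad (y - z)‖ = 0 := by
    have := nonpos_of_mul_nonpos_right h1 h0
    exact pow_eq_zero_iff two_ne_zero |>.1 (this.antisymm (sq_nonneg _))
  have h3 : ‖H10.fn (y - z)‖ = 0 :=
    ((hC (y - z)).trans_eq (by rw [h2, mul_zero])).antisymm (norm_nonneg _)
  have h4 := H10.norm_sq (y - z)
  rw [h2, h3] at h4
  exact sub_eq_zero.1 (norm_eq_zero.1 (pow_eq_zero_iff two_ne_zero |>.1 (by simpa using h4)))

/-- Reciprocity: solutions `y` for `r` and `p` for `q` satisfy `(q, y) = (r, p)`. -/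
theorem IsWeakSolution.inner_comm (hΩ : IsOpen Ω) (hm : AEMeasurable ν (volume.restrict Ω))
    (h0 : 0 < νlow) (hb : ∀ x ∈ Ω, νlow ≤ ν x ∧ ν x ≤ νup) {r q : L2 Ω} {y p : H10 Ω}
    (hy : IsWeakSolution ν r y) (hp : IsWeakSolution ν q p) :
    ⟪q, H10.fn y⟫ = ⟪H10.fn p, r⟫ := by
  rw [← hp y, inner_flux_comm hΩ hm h0 hb, hy p, real_inner_comm]

end Flux

/-! ### The optimality system, the control problem and the projection formula. -/

section Control

variable {d : ℕ} {Ω : Set (E d)} {ua ub : L2 Ω}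

theorem mem_Uad_iff {v : L2 Ω} : v ∈ Uad ua ub ↔ ua ≤ v ∧ v ≤ ub := by
  rw [← Lp.coeFn_le, ← Lp.coeFn_le]
  constructor
  · intro (h : ∀ᵐ x ∂(volume.restrict Ω), ua x ≤ v x ∧ v x ≤ ub x)
    exact ⟨h.mono fun _ hx => hx.1, h.mono fun _ hx => hx.2⟩
  · exact fun h => h.1.and h.2

theorem Uad_eq_Icc : Uad ua ub = Set.Icc ua ub := Set.ext fun _ => mem_Uad_iff

theorem isClosed_Uad : IsClosed (Uad ua ub) := by
  rw [Uad_eq_Icc]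
  exact isClosed_Icc

theorem convex_Uad : Convex ℝ (Uad ua ub) := by
  intro v hv w hw a b ha hb hab
  filter_upwards [hv, hw, Lp.coeFn_add (a • v) (b • w), Lp.coeFn_smul a v, Lp.coeFn_smul b w]
    with x h1 h2 h3 h4 h5
  rw [h3, Pi.add_apply, h4, h5]
  exact convex_Icc (ua x) (ub x) h1 h2 ha hb hab

variable {ν : E d → ℝ} {νlow νup lam : ℝ} {f yd ud : L2 Ω}

theorem OptimalitySystem.unique (hd : 1 ≤ d) (hΩ : IsOpen Ω) (hΩb : Bornology.IsBounded Ω)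
    (hm : AEMeasurable ν (volume.restrict Ω))
    (h0 : 0 < νlow) (hb : ∀ x ∈ Ω, νlow ≤ ν x ∧ ν x ≤ νup) (hlam : 0 < lam)
    {y z p q : H10 Ω} {u v : L2 Ω}
    (h : OptimalitySystem ν lam f yd ud ua ub y u p)
    (k : OptimalitySystem ν lam f yd ud ua ub z v q) : y = z ∧ u = v ∧ p = q := by
  have huv : u = v := by
    have h1 := h.variational v k.admissible
    have h2 := k.variational u h.admissible
    -- Reciprocity for the differences of states and adjoints. Adding the two variational
    -- inequalities, each tested with the other control, then gives `λ‖u - v‖² ≤ -(p - q, u - v) =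
    -- -‖y - z‖² ≤ 0`.
    have h3 : ⟪H10.fn y - H10.fn z, H10.fn y - H10.fn z⟫ = ⟪H10.fn p - H10.fn q, u - v⟫ := by
      have := (h.state.sub hΩ hm h0 hb k.state).inner_comm hΩ hm h0 hb
        (h.adjoint.sub hΩ hm h0 hb k.adjoint)
      rwa [sub_sub_sub_cancel_right, add_sub_add_left_eq_sub] at this
    have h4 : 0 ≤ ⟪H10.fn y - H10.fn z, H10.fn y - H10.fn z⟫ := real_inner_self_nonneg
    have h5 : lam * ⟪u - v, u - v⟫ ≤ 0 := by
      simp only [inner_add_left, inner_sub_left, inner_sub_right, real_inner_smul_left]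
        at h1 h2 h3 h4 ⊢
      linarith
    exact sub_eq_zero.1 (real_inner_self_nonpos.1 (nonpos_of_mul_nonpos_right h5 hlam))
  subst huv
  have hyz : y = z := h.state.unique hd hΩ hΩb hm h0 hb k.state
  subst hyz
  exact ⟨rfl, rfl, h.adjoint.unique hd hΩ hΩb hm h0 hb k.adjoint⟩

theorem OptimalitySystem.exists (hd : 1 ≤ d) (hΩ : IsOpen Ω) (hΩb : Bornology.IsBounded Ω)
    (hm : AEMeasurable ν (volume.restrict Ω))
    (h0 : 0 < νlow) (hb : ∀ x ∈ Ω, νlow ≤ ν x ∧ ν x ≤ νup) (hlam : 0 < lam)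
    (hab : ∀ᵐ x ∂(volume.restrict Ω), ua x ≤ ub x) (f yd ud : L2 Ω) :
    ∃ y u p, OptimalitySystem ν lam f yd ud ua ub y u p := by
  obtain ⟨S, hS⟩ := exists_solution_operator hd hΩ hΩb hm h0 hb
  have hne : (Uad ua ub).Nonempty := ⟨ua, by filter_upwards [hab] with x hx; exact ⟨le_rfl, hx⟩⟩
  -- The state is affine in the control, `y = S f + S u`; the constant part `S f` is moved into the
  -- target `y_d - S f`.
  obtain ⟨u, hu, hvar⟩ := exists_variational_inequality ((H10.fnL Ω).comp S) hne isClosed_Uad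
    convex_Uad hlam (yd - H10.fn (S f)) ud
  have hy : H10.fn (S (f + u)) - yd = (H10.fnL Ω).comp S u - (yd - H10.fn (S f)) := by
    rw [map_add]
    show H10.fn (S f) + H10.fn (S u) - yd = H10.fn (S u) - (yd - H10.fn (S f))
    abel
  refine ⟨S (f + u), u, S (H10.fn (S (f + u)) - yd), hu, hS _, hS _, fun w hw => ?_⟩
  have h := hvar w hw
  rw [← hy] at h
  have h2 := (hS (w - u)).inner_comm hΩ hm h0 hb (hS (H10.fn (S (f + u)) - yd))
  rw [inner_add_left, real_inner_smul_left, ← h2]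
  exact h

/-- Quadratic growth of the cost at `(y, u)`. The expansion of `J` is exact; by reciprocity its
linear part is the left side of the variational inequality, hence nonnegative, and of the quadratic
part only `½‖z - y‖²` is discarded. -/
theorem OptimalitySystem.cost_add_le (hΩ : IsOpen Ω)
    (hm : AEMeasurable ν (volume.restrict Ω))
    (h0 : 0 < νlow) (hb : ∀ x ∈ Ω, νlow ≤ ν x ∧ ν x ≤ νup)
    {y p : H10 Ω} {u : L2 Ω} (h : OptimalitySystem ν lam f yd ud ua ub y u p)
    {z : H10 Ω} {v : L2 Ω} (hv : v ∈ Uad ua ub) (hz : IsWeakSolution ν (f + v) z) :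
    cost lam yd ud (H10.fn y) u + lam / 2 * ‖v - u‖ ^ 2 ≤ cost lam yd ud (H10.fn z) v := by
  have h1 := h.variational v hv
  have h2 := (hz.sub hΩ hm h0 hb h.state).inner_comm hΩ hm h0 hb h.adjoint
  rw [add_sub_add_left_eq_sub, H10.fn_sub] at h2
  rw [inner_add_left, ← h2, real_inner_smul_left] at h1
  have e1 : ‖H10.fn z - yd‖ ^ 2 = ‖H10.fn y - yd‖ ^ 2
      + 2 * ⟪H10.fn y - yd, H10.fn z - H10.fn y⟫ + ‖H10.fn z - H10.fn y‖ ^ 2 := by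
    rw [← norm_add_sq_real]
    congr 2
    abel
  have e2 : ‖v - ud‖ ^ 2 = ‖u - ud‖ ^ 2 + 2 * ⟪u - ud, v - u⟫ + ‖v - u‖ ^ 2 := by
    rw [← norm_add_sq_real]
    congr 2
    abel
  have e3 := sq_nonneg ‖H10.fn z - H10.fn y‖
  unfold cost
  rw [e1, e2]
  linarith

theorem optimalitySystem_iff (hd : 1 ≤ d) (hΩ : IsOpen Ω) (hΩb : Bornology.IsBounded Ω)
    (hm : AEMeasurable ν (volume.restrict Ω))
    (h0 : 0 < νlow) (hb : ∀ x ∈ Ω, νlow ≤ ν x ∧ ν x ≤ νup) (hlam : 0 < lam)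
    (hab : ∀ᵐ x ∂(volume.restrict Ω), ua x ≤ ub x) {y p : H10 Ω} {u : L2 Ω} :
    OptimalitySystem ν lam f yd ud ua ub y u p ↔
      IsOptimal ν lam f yd ud ua ub y u ∧ IsWeakSolution ν (H10.fn y - yd) p := by
  refine ⟨fun h => ⟨⟨h.admissible, h.state, fun z v hv hz => ?_⟩, h.adjoint⟩, ?_⟩
  · have := h.cost_add_le hΩ hm h0 hb hv hz
    have : 0 ≤ lam / 2 * ‖v - u‖ ^ 2 := by positivity
    linarith
  · rintro ⟨h, hp⟩
    -- No derivative of the cost is needed: quadratic growth at a solution of the system, compared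
    -- with the minimality of `(y, u)`, forces the two controls to coincide.
    obtain ⟨z, v, q, k⟩ := OptimalitySystem.exists hd hΩ hΩb hm h0 hb hlam hab f yd ud
    have h1 := k.cost_add_le hΩ hm h0 hb h.admissible h.state
    have h2 := h.minimal z v k.admissible k.state
    have h3 : ‖u - v‖ ^ 2 ≤ 0 :=
      nonpos_of_mul_nonpos_right (by linarith : lam / 2 * ‖u - v‖ ^ 2 ≤ 0) (half_pos hlam)
    have huv : u = v := sub_eq_zero.1 (norm_eq_zero.1
      (pow_eq_zero_iff two_ne_zero |>.1 (h3.antisymm (sq_nonneg _))))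
    subst huv
    have hyz : y = z := h.state.unique hd hΩ hΩb hm h0 hb k.state
    subst hyz
    exact ⟨h.admissible, h.state, hp, (hp.unique hd hΩ hΩb hm h0 hb k.adjoint) ▸ k.variational⟩

theorem projControl_mem_Uad (lam : ℝ) (ud ζ : L2 Ω)
    (hab : ∀ᵐ x ∂(volume.restrict Ω), ua x ≤ ub x) :
    projControl lam ud ua ub ζ ∈ Uad ua ub :=
  mem_Uad_iff.2 ⟨le_inf ((Lp.coeFn_le _ _).1 hab) le_sup_left, inf_le_left⟩

/-- Obtuse-angle criterion for the projection of `c` onto the interval `[a, b]`. -/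
theorem mul_sub_clamp_nonneg {a b c t : ℝ} (ha : a ≤ t) (hb : t ≤ b) :
    0 ≤ (min b (max a c) - c) * (t - min b (max a c)) := by
  rcases le_total a c with h1 | h1
  · rw [max_eq_right h1]
    rcases le_total b c with h2 | h2
    · rw [min_eq_left h2]
      exact mul_nonneg_of_nonpos_of_nonpos (by linarith) (by linarith)
    · rw [min_eq_right h2, sub_self, zero_mul]
  · rw [max_eq_left h1, min_eq_right (ha.trans hb)]
    exact mul_nonneg (by linarith) (by linarith)

/-- `v_ζ` satisfies the variational inequality of the projection onto `U_ad`. -/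
theorem projControl_variational (hlam : 0 < lam) (ζ : L2 Ω) {w : L2 Ω} (hw : w ∈ Uad ua ub) :
    0 ≤ ⟪ζ + lam • (projControl lam ud ua ub ζ - ud), w - projControl lam ud ua ub ζ⟫ := by
  set v := projControl lam ud ua ub ζ with hv
  rw [L2.inner_def]
  refine integral_nonneg_of_ae ?_
  filter_upwards [hw, coeFn_projControl lam ud ua ub ζ, Lp.coeFn_add ζ (lam • (v - ud)),
    Lp.coeFn_smul lam (v - ud), Lp.coeFn_sub v ud, Lp.coeFn_sub w v] with x h1 h2 h3 h4 h5 h6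
  rw [h3, h6, Pi.add_apply, Pi.sub_apply, h4, Pi.smul_apply, h5, Pi.sub_apply]
  have h := mul_nonneg hlam.le (mul_sub_clamp_nonneg (c := ud x - 1 / lam * ζ x) h1.1 h1.2)
  rw [← h2, ← hv] at h
  -- With `c = u_d - ζ/λ` this identifies `λ (v - c)` with `ζ + λ (v - u_d)`.
  have e : lam * (1 / lam) = 1 := mul_one_div_cancel hlam.ne'
  show 0 ≤ (w x - v x) * (ζ x + lam * (v x - ud x))
  linear_combination h + (w x - v x) * ζ x * e

/-- The variational inequality with fixed `p` has at most one solution in `U_ad`: testing each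
candidate with the other gives `λ‖v_p - u‖² ≤ 0`. -/
theorem OptimalitySystem.projControl_eq (hlam : 0 < lam)
    (hab : ∀ᵐ x ∂(volume.restrict Ω), ua x ≤ ub x) {y p : H10 Ω} {u : L2 Ω}
    (h : OptimalitySystem ν lam f yd ud ua ub y u p) :
    projControl lam ud ua ub (H10.fn p) = u := by
  have h1 := h.variational _ (projControl_mem_Uad lam ud (H10.fn p) hab)
  have h2 := projControl_variational (ud := ud) hlam (H10.fn p) h.admissible
  set v := projControl lam ud ua ub (H10.fn p)
  have h3 : lam * ⟪v - u, v - u⟫ ≤ 0 := by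
    simp only [inner_add_left, inner_sub_left, inner_sub_right, real_inner_smul_left] at h1 h2 ⊢
    linarith
  exact sub_eq_zero.1 (real_inner_self_nonpos.1 (nonpos_of_mul_nonpos_right h3 hlam))

end Control

/-! ### Nonnegativity of the majorant and its value at the exact solution. -/

section Majorant

variable {d : ℕ} {Ω : Set (E d)} {ν : E d → ℝ} {νlow νup lam CF : ℝ} {f yd : L2 Ω}

/-- The residual functional of `H¹₀(Ω)` is controlled by the Friedrichs inequality. -/
theorem abs_residual_le (hCF : IsFriedrichsConstant Ω CF) (r : L2 Ω) (g : L2Vec Ω) (w : H10 Ω) :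
    |⟪r, H10.fn w⟫ + ⟪g, H10.grad w⟫| ≤ (CF * ‖r‖ + ‖g‖) * ‖H10.grad w‖ := by
  have h1 := abs_real_inner_le_norm r (H10.fn w)
  have h2 := abs_real_inner_le_norm g (H10.grad w)
  have h3 := mul_le_mul_of_nonneg_left (hCF.2 w) (norm_nonneg r)
  refine (abs_add_le _ _).trans ?_
  linarith

/-- Young's inequality with two parameters. -/
theorem half_sq_add_le {a A B α β : ℝ} (hα : 0 < α) (hβ : 0 < β) :
    1 / 2 * (a + (A + B)) ^ 2 ≤ (1 + α) / 2 * a ^ 2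
      + (1 + α) * (1 + β) / (2 * α) * A ^ 2 + (1 + α) * (1 + β) / (2 * α * β) * B ^ 2 := by
  have h : (1 + α) / 2 * a ^ 2 + (1 + α) * (1 + β) / (2 * α) * A ^ 2
      + (1 + α) * (1 + β) / (2 * α * β) * B ^ 2 - 1 / 2 * (a + (A + B)) ^ 2
      = (α * a - (A + B)) ^ 2 / (2 * α) + (1 + α) * (β * A - B) ^ 2 / (2 * α * β) := by
    field_simp
    ring
  have : 0 ≤ (α * a - (A + B)) ^ 2 / (2 * α) + (1 + α) * (β * A - B) ^ 2 / (2 * α * β) := by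
    positivity
  linarith

theorem majorantH1_nonneg (hd : 1 ≤ d) (hΩ : IsOpen Ω) (hΩb : Bornology.IsBounded Ω)
    (hm : AEMeasurable ν (volume.restrict Ω))
    (h0 : 0 < νlow) (hb : ∀ x ∈ Ω, νlow ≤ ν x ∧ ν x ≤ νup) (hlam : 0 < lam)
    (hCF : IsFriedrichsConstant Ω CF) {α β : ℝ} (hα : 0 < α) (hβ : 0 < β) (η ζ : H10 Ω)
    (τ ρ : Hdiv Ω) (v : L2 Ω) :
    0 ≤ majorantH1 ν νlow lam CF f yd α β η ζ τ ρ v := by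
  obtain ⟨S, hS⟩ := exists_solution_operator hd hΩ hΩb hm h0 hb
  set y := S (f + v)
  have hy : IsWeakSolution ν (f + v) y := hS _
  -- `e` is the error of `η` as an approximation of the state belonging to the given `v`, which need
  -- not be optimal or admissible.
  set e := y - η with he
  unfold majorantH1
  set r₁ := f + v + Hdiv.div τ with hr₁
  set r₂ := Hdiv.field τ - flux ν (H10.grad η) with hr₂
  set s₁ := H10.fn η - yd + Hdiv.div ρ with hs₁
  set s₂ := Hdiv.field ρ - flux ν (H10.grad ζ) with hs₂
  have hCF0 := hCF.1
  have herr : ∀ w, ⟪flux ν (H10.grad e), H10.grad w⟫ = ⟪r₁, H10.fn w⟫ + ⟪r₂, H10.grad w⟫ := by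
    intro w
    have h1 := Hdiv.inner_div_add τ w
    have h2 := hy w
    rw [he, hr₁, hr₂, H10.grad_sub, flux_sub hΩ hm h0 hb, inner_sub_left, inner_sub_left,
      inner_add_left, h2]
    linarith
  -- The adjoint residual evaluated at `e`; Green's formula inserts `ρ` at no cost.
  have hadj : ⟪H10.fn η - yd, H10.fn e⟫ - ⟪flux ν (H10.grad ζ), H10.grad e⟫
      = ⟪s₁, H10.fn e⟫ + ⟪s₂, H10.grad e⟫ := by
    have h1 := Hdiv.inner_div_add ρ e
    rw [hs₁, hs₂, inner_add_left, inner_sub_left (Hdiv.field ρ)]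
    linarith
  have hζ := herr ζ
  rw [inner_flux_comm hΩ hm h0 hb] at hζ
  have hgrad : ‖H10.grad e‖ ≤ (CF * ‖r₁‖ + ‖r₂‖) / νlow := by
    have h1 := (le_abs_self _).trans (abs_residual_le hCF r₁ r₂ e)
    rw [← herr e] at h1
    have h2 := (mul_norm_sq_le_inner_flux hΩ hm h0 hb (H10.grad e)).trans h1
    rw [le_div_iff₀ h0]
    rcases (norm_nonneg (H10.grad e)).eq_or_lt with h3 | h3
    · rw [← h3, zero_mul]
      positivity
    · refine le_of_mul_le_mul_right ?_ h3
      linarith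
  have hfn : ‖H10.fn e‖ ≤ CF / νlow * ‖r₂‖ + CF ^ 2 / νlow * ‖r₁‖ := by
    refine (hCF.2 e).trans ((mul_le_mul_of_nonneg_left hgrad hCF0.le).trans_eq ?_)
    field_simp
    ring
  have hpair : -((CF * ‖s₁‖ + ‖s₂‖) * ((CF * ‖r₁‖ + ‖r₂‖) / νlow))
      ≤ ⟪s₁, H10.fn e⟫ + ⟪s₂, H10.grad e⟫ :=
    (neg_le_neg (mul_le_mul_of_nonneg_left hgrad (by positivity))).trans
      (neg_le_of_abs_le (abs_residual_le hCF s₁ s₂ e))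
  have hyoung := half_sq_add_le (a := ‖H10.fn η - yd‖) (A := CF / νlow * ‖r₂‖)
    (B := CF ^ 2 / νlow * ‖r₁‖) hα hβ
  -- The left side is `½‖y - y_d‖²` without its nonnegative part `½‖e‖²`.
  have hstate : 1 / 2 * ‖H10.fn η - yd‖ ^ 2 + ⟪H10.fn η - yd, H10.fn e⟫
      ≤ 1 / 2 * (‖H10.fn η - yd‖ + (CF / νlow * ‖r₂‖ + CF ^ 2 / νlow * ‖r₁‖)) ^ 2 := by
    have h1 := pow_le_pow_left₀ (norm_nonneg _) ((norm_add_le (H10.fn η - yd) (H10.fn e)).trans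
      (add_le_add_right hfn _)) 2
    have h2 := norm_add_sq_real (H10.fn η - yd) (H10.fn e)
    have h3 := sq_nonneg ‖H10.fn e‖
    linarith
  -- Nonnegativity needs only the state residuals in the second factor; the terms containing `1/λ`
  -- are nonnegative surplus.
  have hprod : (CF * ‖s₁‖ + ‖s₂‖) * ((CF * ‖r₁‖ + ‖r₂‖) / νlow)
      ≤ 1 / νlow * (CF * ‖s₁‖ + ‖s₂‖) * (CF ^ 3 / (lam * νlow) * ‖s₁‖
        + CF ^ 2 / (lam * νlow) * ‖s₂‖ + CF * ‖r₁‖ + ‖r₂‖) := by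
    have h1 : 0 ≤ CF ^ 3 / (lam * νlow) * ‖s₁‖ + CF ^ 2 / (lam * νlow) * ‖s₂‖ := by positivity
    have h2 : 0 ≤ 1 / νlow * (CF * ‖s₁‖ + ‖s₂‖) := by positivity
    calc (CF * ‖s₁‖ + ‖s₂‖) * ((CF * ‖r₁‖ + ‖r₂‖) / νlow)
        = 1 / νlow * (CF * ‖s₁‖ + ‖s₂‖) * (CF * ‖r₁‖ + ‖r₂‖) := by ring
      _ ≤ _ := mul_le_mul_of_nonneg_left (by linarith) h2
  have hlast : 0 ≤ 3 * lam / (2 * CF ^ 2) * (‖r₂‖ + CF * ‖r₁‖) ^ 2 := by positivity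
  have e1 : (1 + α) * (1 + β) / (2 * α) * (CF / νlow * ‖r₂‖) ^ 2
      = (1 + α) * (1 + β) * CF ^ 2 / (2 * α * νlow ^ 2) * ‖r₂‖ ^ 2 := by
    field_simp
  have e2 : (1 + α) * (1 + β) / (2 * α * β) * (CF ^ 2 / νlow * ‖r₁‖) ^ 2
      = (1 + α) * (1 + β) * CF ^ 4 / (2 * α * β * νlow ^ 2) * ‖r₁‖ ^ 2 := by
    field_simp
  rw [e1, e2] at hyoung
  linarith

/-- At a solution of the optimality system, with the exact fluxes, only one term remains. -/
theorem majorantH1_exact {y p : H10 Ω} {u : L2 Ω} {τ ρ : Hdiv Ω} (νlow lam CF α β : ℝ)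
    (hτ : Hdiv.field τ = flux ν (H10.grad y)) (hτd : Hdiv.div τ = -(f + u))
    (hρ : Hdiv.field ρ = flux ν (H10.grad p)) (hρd : Hdiv.div ρ = -(H10.fn y - yd)) :
    majorantH1 ν νlow lam CF f yd α β y p τ ρ u = α / 2 * ‖H10.fn y - yd‖ ^ 2 := by
  unfold majorantH1
  rw [hτ, hτd, hρ, hρd]
  simp

/-- The state and adjoint equations say exactly that `ν∇y` and `ν∇p` have weak divergences `-(f +
u)` and `-(y - y_d)`, so every residual vanishes. -/
theorem OptimalitySystem.exists_fluxes {ua ub ud : L2 Ω} {y p : H10 Ω} {u : L2 Ω}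
    (h : OptimalitySystem ν lam f yd ud ua ub y u p) (νlow CF : ℝ) :
    ∃ τ ρ : Hdiv Ω, Hdiv.field τ = flux ν (H10.grad y) ∧
      Hdiv.field ρ = flux ν (H10.grad p) ∧
      ∀ β : ℝ, 0 < β →
        Tendsto (fun α : ℝ => majorantH1 ν νlow lam CF f yd α β y p τ ρ u) (𝓝[>] 0) (𝓝 0) := by
  obtain ⟨τ, hτ, hτd⟩ := exists_hdiv_of_inner_eq h.state
  obtain ⟨ρ, hρ, hρd⟩ := exists_hdiv_of_inner_eq h.adjoint
  refine ⟨τ, ρ, hτ, hρ, fun β _ => ?_⟩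
  simp only [majorantH1_exact _ _ _ _ _ hτ hτd hρ hρd]
  have hc : Continuous fun α : ℝ => α / 2 * ‖H10.fn y - yd‖ ^ 2 := by fun_prop
  simpa using (hc.tendsto 0).mono_left nhdsWithin_le_nhds

end Majorant

end EllipticControl

end

/-! ### The infimum of the majorant and the optimality system. -/

theorem mainTheorem8 {d : ℕ} (hd : 1 ≤ d)
    (Ω : Set (E d)) (hΩo : IsOpen Ω) (hΩb : Bornology.IsBounded Ω)
    (ν : E d → ℝ) (νlow νup : ℝ) (hνm : AEMeasurable ν (volume.restrict Ω))
    (hνlow : 0 < νlow) (hν : ∀ x ∈ Ω, νlow ≤ ν x ∧ ν x ≤ νup)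
    (lam : ℝ) (hlam : 0 < lam)
    (f yd ud ua ub : L2 Ω) (hab : ∀ᵐ x ∂(volume.restrict Ω), ua x ≤ ub x) :
    -- the optimality system has exactly one solution
    (∃! s : H10 Ω × L2 Ω × H10 Ω,
      OptimalitySystem ν lam f yd ud ua ub s.1 s.2.1 s.2.2) ∧
    -- it is equivalent to the optimal control problem together with the adjoint equation
    (∀ (y : H10 Ω) (u : L2 Ω) (p : H10 Ω),
      OptimalitySystem ν lam f yd ud ua ub y u p ↔
        IsOptimal ν lam f yd ud ua ub y u ∧ IsWeakSolution ν (H10.fn y - yd) p) ∧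
    -- the Friedrichs inequality holds with some constant
    (∃ CF : ℝ, IsFriedrichsConstant Ω CF) ∧
    ∀ CF : ℝ, IsFriedrichsConstant Ω CF →
      -- the infimum of the majorant over all its arguments is zero
      IsGLB {m : ℝ | ∃ (α β : ℝ) (η ζ : H10 Ω) (τ ρ : Hdiv Ω), 0 < α ∧ 0 < β ∧
        m = majorantH1 ν νlow lam CF f yd α β η ζ τ ρ
          (projControl lam ud ua ub (H10.fn ζ))} 0 ∧
      -- it is approached at the exact solution and the exact fluxes as `α → 0`
      ∀ (y : H10 Ω) (u : L2 Ω) (p : H10 Ω), OptimalitySystem ν lam f yd ud ua ub y u p →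
        projControl lam ud ua ub (H10.fn p) = u ∧
        ∃ τ ρ : Hdiv Ω, Hdiv.field τ = flux ν (H10.grad y) ∧
          Hdiv.field ρ = flux ν (H10.grad p) ∧
          ∀ β : ℝ, 0 < β →
            Tendsto (fun α : ℝ => majorantH1 ν νlow lam CF f yd α β y p τ ρ u)
              (𝓝[>] 0) (𝓝 0) := by
  have hex := OptimalitySystem.exists hd hΩo hΩb hνm hνlow hν hlam hab f yd ud
  refine ⟨?_, fun y u p => optimalitySystem_iff hd hΩo hΩb hνm hνlow hν hlam hab,
    exists_isFriedrichsConstant hd hΩo hΩb, fun CF hCF => ⟨⟨?_, ?_⟩, fun y u p h =>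
      ⟨h.projControl_eq hlam hab, h.exists_fluxes νlow CF⟩⟩⟩
  · obtain ⟨y, u, p, h⟩ := hex
    refine ⟨(y, u, p), h, ?_⟩
    rintro ⟨z, v, q⟩ k
    obtain ⟨h1, h2, h3⟩ := OptimalitySystem.unique hd hΩo hΩb hνm hνlow hν hlam k h
    exact Prod.ext h1 (Prod.ext h2 h3)
  · rintro m ⟨α, β, η, ζ, τ, ρ, hα, hβ, rfl⟩
    exact majorantH1_nonneg hd hΩo hΩb hνm hνlow hν hlam hCF hα hβ η ζ τ ρ _
  · intro b hb
    obtain ⟨y, u, p, h⟩ := hex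
    obtain ⟨τ, ρ, -, -, hlim⟩ := h.exists_fluxes νlow CF
    -- A lower bound `b` lies below the values along the curve `α → 0` at the exact solution, hence
    -- below their limit 0; the choice `β = 1` is arbitrary.
    refine ge_of_tendsto (hlim 1 one_pos) ?_
    filter_upwards [self_mem_nhdsWithin] with α hα
    refine hb ⟨α, 1, y, p, τ, ρ, hα, one_pos, ?_⟩
    rw [h.projControl_eq hlam hab]
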